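/- Graphs may have loops and parallel edges. A signed graph $(G,\sigma)$ is a graph $G$ with a map $\sigma:E(G)\to\{1,-1\}$. Each edge consists of two half edges, one incident with each of its ends (both incident with the same vertex if the edge is a loop). An orientation of $(G,\sigma)$ is a map $\tau$ from the half edges to $\{1,-1\}$ such that $\tau(h)\tau(h')=-\sigma(e)$ for every edge $e$ with half edges $h,h'$. For an integer $k\ge 2$, a nowhere-zero $k$-flow of $(G,\sigma)$ is a pair $(\tau,f)$ of an orientation $\tau$ and a map $f:E(G)\to\mathbb{Z}$ such that $0<|f(e)|<k$ for every edge $e$ and $\sum_{h}\tau(h)f(e_h)=0$ for every vertex $v$, where the sum is over the half edges $h$ incident with $v$ and $e_h$ is the edge containing $h$. The signed graph $(G,\sigma)$ is flow-admissible if it has a nowhere-zero $k$-flow for some integer $k\ge 2$. For $n\ge 1$, the circular ladder $CL_n=C_n\Box K_2$ is the cubic graph with vertices $x_i,y_i$ and with $3n$ edges $x_iy_i$, $x_ix_{i+1}$, $y_iy_{i+1}$ $(i\in\mathbb{Z}/n\mathbb{Z})$; for $n=1$ the edges $x_0x_1$ and $y_0y_1$ are loops, and for $n=2$ the edges $x_0x_1,x_1x_0$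 are parallel, as are $y_0y_1,y_1y_0$. **Theorem 5.6.** Let $n\ge 1$, let $G$ be a graph isomorphic to $CL_n$, and let $\sigma:E(G)\to\{1,-1\}$. If $(G,\sigma)$ is flow-admissible, then $(G,\sigma)$ admits a nowhere-zero $6$-flow. -/

import Mathlib

/-- A graph with vertex set `V` and edge set `E`, loops and parallel edges allowed.
Every edge `e` consists of the two half edges `(e, false)` and `(e, true)`, and `G.vert h` is the
vertex with which the half edge `h` is incident. The edge `e` is a loop when its two half edges are
incident with the same vertex. -/
structure MGraph (V E : Type*) where
  /-- the vertex with which a half edge is incident -/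
  vert : E × Bool → V

namespace MGraph

/-- The unordered pair of ends of an edge. -/
def ends {V E : Type*} (G : MGraph V E) (e : E) : Sym2 V :=
  s(G.vert (e, false), G.vert (e, true))

/-- Isomorphism of graphs: bijections of the vertices and of the edges that respect ends. -/
structure Iso {V E V' E' : Type*} (G : MGraph V E) (G' : MGraph V' E') where
  /-- the bijection of the vertex sets -/
  onVert : V ≃ V'
  /-- the bijection of the edge sets -/
  onEdge : E ≃ E'
  ends_map : ∀ e : E, G'.ends (onEdge e) = (G.ends e).map onVert

/-- `τ` is an orientation of the signed graph `(G, σ)`: a map from the half edges to `{1, -1}` such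
that the two half edges of `e` get values with product `-σ e`. The value `1` means that the half
edge is oriented away from its vertex, `-1` that it is oriented toward its vertex. (The incidences
of the graph play no role in this condition.) -/
def IsOrientation {E : Type*} (σ : E → ℤˣ) (τ : E × Bool → ℤˣ) : Prop :=
  ∀ e : E, τ (e, false) * τ (e, true) = -σ e

open Classical in
/-- The boundary of `f` at `v`: the sum of `τ h * f e` over all half edges `h` incident with `v`,
where `e = h.1` is the edge containing `h`. -/
noncomputable def boundary {V E : Type*} [Fintype E] (G : MGraph V E) (τ : E × Bool → ℤˣ)
    (f : E → ℤ) (v : V) : ℤ :=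
  ∑ h : E × Bool with G.vert h = v, (τ h : ℤ) * f h.1

/-- `(τ, f)` is an (integer) `k`-flow of the signed graph `(G, σ)`. -/
structure IsFlow {V E : Type*} [Fintype E] (G : MGraph V E) (σ : E → ℤˣ) (k : ℕ)
    (τ : E × Bool → ℤˣ) (f : E → ℤ) : Prop where
  orientation : IsOrientation σ τ
  boundary_eq_zero : ∀ v : V, G.boundary τ f v = 0
  abs_lt : ∀ e : E, |f e| < (k : ℤ)

/-- The signed graph `(G, σ)` admits a nowhere-zero `k`-flow. -/
def HasNowhereZeroFlow {V E : Type*} [Fintype E] (G : MGraph V E) (σ : E → ℤˣ) (k : ℕ) : Prop :=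
  ∃ (τ : E × Bool → ℤˣ) (f : E → ℤ), G.IsFlow σ k τ f ∧ ∀ e : E, f e ≠ 0

/-- The signed graph `(G, σ)` is flow-admissible: it admits a nowhere-zero `k`-flow for some
integer `k ≥ 2`. -/
def FlowAdmissible {V E : Type*} [Fintype E] (G : MGraph V E) (σ : E → ℤˣ) : Prop :=
  ∃ k : ℕ, 2 ≤ k ∧ G.HasNowhereZeroFlow σ k

/-- The graph `CL_n`, the Cartesian product of the circuit `C_n` and `K_2`, for `n ≥ 1`.
Its vertices are `x_i = (false, i)` and `y_i = (true, i)` for `i ∈ ℤ/n`. Its edges are the rungs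
`inl i`, joining `x_i` to `y_i`, and the rails `inr (s, i)`, joining `(s, i)` to `(s, i + 1)`, that
is, `x_i` to `x_{i+1}` for `s = false` and `y_i` to `y_{i+1}` for `s = true`.
In `CL_1` the rails are loops and in `CL_2` they form two pairs of parallel edges, so `CL_n` is
cubic for every `n ≥ 1`. -/
def circularLadder (n : ℕ) : MGraph (Bool × ZMod n) (ZMod n ⊕ Bool × ZMod n) where
  vert
    | (Sum.inl i, b) => (b, i)
    | (Sum.inr (s, i), false) => (s, i)
    | (Sum.inr (s, i), true) => (s, i + 1)

/-- A circular ladder is a graph isomorphic to `CL_n` for some `n ≥ 1`. -/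
def IsCircularLadder {V E : Type*} (G : MGraph V E) : Prop :=
  ∃ n : ℕ, 1 ≤ n ∧ Nonempty (G.Iso (circularLadder n))

end MGraph

/-! Cut the ladder open and switch so that all rails except the two closing ones are positive. A
flow becomes a walk of pairs (a, b), the flows along the two rails: a positive rung keeps a + b and
changes a - b, a negative rung keeps a - b and changes a + b. Going round must turn (a, b) into (±a,
±b), the signs being the products of the rail signs.

The given flow forces conditions on the rung signs alone. With both closing signs positive, neither
rung sign occurs exactly once; with both negative nothing is needed; with one of each, the rung
signs form at least three runs. A finite automaton tracks these conditions. Each of its states gets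
a finite set of pairs below 6, chosen so that every pair has a predecessor; `exists_ladderWalk` then
builds a walk backward from the required end, and only finite checks remain. -/

namespace MGraph

/-! ### Flows as functions on half edges -/

/-- A nowhere-zero `k`-flow written as the function `h ↦ τ h * f h.1` on half edges. -/
structure IsHalfEdgeFlow {V E : Type*} [Fintype E] (G : MGraph V E) (σ : E → ℤˣ) (k : ℕ)
    (F : E × Bool → ℤ) : Prop where
  flip : ∀ e b, F (e, !b) = -(σ e : ℤ) * F (e, b)
  ne_zero : ∀ h, F h ≠ 0
  abs_lt : ∀ h, |F h| < (k : ℤ)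
  sum_eq_zero : ∀ v, (open Classical in ∑ h : E × Bool, if G.vert h = v then F h else 0) = 0

theorem abs_units_mul (u : ℤˣ) (x : ℤ) : |(u : ℤ) * x| = |x| := by
  rcases Int.units_eq_one_or u with rfl | rfl <;> simp

theorem units_mul_self_mul (u : ℤˣ) (x : ℤ) : (u : ℤ) * ((u : ℤ) * x) = x := by
  rcases Int.units_eq_one_or u with rfl | rfl <;> simp

theorem hasNowhereZeroFlow_iff {V E : Type*} [Fintype E] (G : MGraph V E) (σ : E → ℤˣ) (k : ℕ) :
    G.HasNowhereZeroFlow σ k ↔ ∃ F, G.IsHalfEdgeFlow σ k F := by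
  constructor
  · rintro ⟨τ, f, ⟨hτ, hb, hk⟩, hf⟩
    refine ⟨fun h => τ h * f h.1, ?_, fun h => by simp [hf], fun h => ?_, fun v => ?_⟩
    · intro e b
      have h := hτ e
      have hs : σ e = -(τ (e, false) * τ (e, true)) := by rw [h, neg_neg]
      rw [hs]
      rcases Int.units_eq_one_or (τ (e, false)) with h1 | h1 <;>
      rcases Int.units_eq_one_or (τ (e, true)) with h2 | h2 <;> cases b <;> simp [h1, h2]
    · rw [abs_units_mul]
      exact hk _
    · have := hb v
      rwa [boundary, Finset.sum_filter] at this
  · rintro ⟨F, h1, h2, h3, h4⟩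
    -- Orient every `false` half edge away from its vertex; the signature then fixes the other half.
    refine ⟨fun h => if h.2 then -σ h.1 else 1, fun e => F (e, false), ⟨?_, fun v => ?_, ?_⟩, ?_⟩
    · intro e
      simp
    · rw [← h4 v, boundary, Finset.sum_filter]
      refine Finset.sum_congr rfl fun h _ => ?_
      rcases h with ⟨e, _ | _⟩
      · simp
      · have := h1 e false
        simp only [Bool.not_false] at this
        simp [this]
    · exact fun e => h3 _
    · exact fun e => h2 _

/-- An isomorphism of graphs lifts to a bijection of the half edges. -/
theorem Iso.exists_halfEdge_equiv {V E V' E' : Type*} {G : MGraph V E} {G' : MGraph V' E'}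
    (i : G.Iso G') : ∃ c : E → Bool, ∀ e b,
      G'.vert (i.onEdge e, xor (c e) b) = i.onVert (G.vert (e, b)) := by
  have h : ∀ e, ∃ c : Bool, ∀ b, G'.vert (i.onEdge e, xor c b) = i.onVert (G.vert (e, b)) := by
    intro e
    have := i.ends_map e
    simp only [ends, Sym2.map_mk, Sym2.eq_iff] at this
    rcases this with ⟨h1, h2⟩ | ⟨h1, h2⟩
    · exact ⟨false, by rintro (_ | _) <;> simpa⟩
    · exact ⟨true, by rintro (_ | _) <;> simpa⟩
  choose c hc using h
  exact ⟨c, hc⟩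

/-- Half-edge flows involve no choice of orientation, so they are transported even where the
isomorphism exchanges the two halves of an edge. -/
theorem Iso.hasNowhereZeroFlow_iff {V E V' E' : Type*} [Fintype E] [Fintype E'] {G : MGraph V E}
    {G' : MGraph V' E'} (i : G.Iso G') (σ : E → ℤˣ) (k : ℕ) :
    G.HasNowhereZeroFlow σ k ↔ G'.HasNowhereZeroFlow (σ ∘ i.onEdge.symm) k := by
  classical
  obtain ⟨c, hc⟩ := i.exists_halfEdge_equiv
  let φ : E × Bool ≃ E' × Bool :=
    { toFun := fun h => (i.onEdge h.1, xor (c h.1) h.2)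
      invFun := fun h => (i.onEdge.symm h.1, xor (c (i.onEdge.symm h.1)) h.2)
      left_inv := fun h => by simp
      right_inv := fun h => by simp }
  have hφ : ∀ h, G'.vert (φ h) = i.onVert (G.vert h) := fun h => hc h.1 h.2
  have hflip : ∀ e b, φ (e, !b) = ((φ (e, b)).1, !(φ (e, b)).2) := fun e b => by simp [φ]
  have hsum : ∀ (F : E' × Bool → ℤ) (v : V),
      (∑ h, if G'.vert h = i.onVert v then F h else 0) =
        ∑ h, if G.vert h = v then F (φ h) else 0 := by
    intro F v
    rw [← Equiv.sum_comp φ]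
    refine Finset.sum_congr rfl fun h _ => ?_
    simp [hφ]
  rw [MGraph.hasNowhereZeroFlow_iff, MGraph.hasNowhereZeroFlow_iff]
  constructor
  · rintro ⟨F, h1, h2, h3, h4⟩
    refine ⟨F ∘ φ.symm, fun e b => ?_, fun _ => h2 _, fun _ => h3 _, fun v => ?_⟩
    · have : φ.symm (e, !b) = ((φ.symm (e, b)).1, !(φ.symm (e, b)).2) := by simp [φ]
      simp only [Function.comp, this, h1]
      simp [φ]
    · obtain ⟨w, rfl⟩ := i.onVert.surjective v
      have := hsum (F ∘ φ.symm) w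
      simp only [Function.comp, Equiv.symm_apply_apply] at this
      simp only [Function.comp]
      convert this.trans ?_
      convert h4 w
  · rintro ⟨F, h1, h2, h3, h4⟩
    refine ⟨F ∘ φ, fun e b => ?_, fun _ => h2 _, fun _ => h3 _, fun v => ?_⟩
    · simp only [Function.comp, hflip, h1]
      simp [φ]
    · have := h4 (i.onVert v)
      simp only [Function.comp]
      rw [← hsum F v]
      convert this

theorem isHalfEdgeFlow_circularLadder_iff (n : ℕ) [NeZero n] (σ : ZMod n ⊕ Bool × ZMod n → ℤˣ)
    (k : ℕ) (F : (ZMod n ⊕ Bool × ZMod n) × Bool → ℤ) :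
    (circularLadder n).IsHalfEdgeFlow σ k F ↔
      (∀ e, F (e, true) = -(σ e : ℤ) * F (e, false)) ∧
      (∀ e, F (e, false) ≠ 0 ∧ |F (e, false)| < (k : ℤ)) ∧
      ∀ s i, F (Sum.inl (i + 1), s) + F (Sum.inr (s, i + 1), false) +
        F (Sum.inr (s, i), true) = 0 := by
  classical
  have key : ∀ s i, (∑ h, if (circularLadder n).vert h = (s, i + 1) then F h else 0) =
      F (Sum.inl (i + 1), s) + F (Sum.inr (s, i + 1), false) + F (Sum.inr (s, i), true) := by
    intro s i
    rw [Fintype.sum_prod_type]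
    simp only [Fintype.sum_bool, Finset.sum_add_distrib, Fintype.sum_sum_type,
      Fintype.sum_prod_type, circularLadder, Prod.mk.injEq, ite_and, add_left_inj]
    cases s <;> simp <;> ring
  constructor
  · rintro ⟨h1, h2, h3, h4⟩
    refine ⟨fun e => h1 e false, fun e => ⟨h2 _, h3 _⟩, fun s i => ?_⟩
    rw [← key]
    convert h4 (s, i + 1)
  · rintro ⟨h1, h2, h3⟩
    refine ⟨?_, ?_, ?_, ?_⟩
    · rintro e (_ | _)
      · exact h1 e
      · rw [h1, neg_mul, neg_mul, mul_neg, neg_neg, units_mul_self_mul]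
        rfl
    · rintro ⟨e, _ | _⟩
      · exact (h2 e).1
      · rw [h1]
        simpa using (h2 e).1
    · rintro ⟨e, _ | _⟩
      · exact (h2 e).2
      · rw [h1, neg_mul, abs_neg, abs_units_mul]
        exact (h2 e).2
    · rintro ⟨s, i⟩
      have := key s (i - 1)
      rw [h3, sub_add_cancel] at this
      convert this

end MGraph


/-! ### Walks of rail flows and their automata -/

/-- Passing a rung of sign `ε` changes the flows on the two rails from `p` to `q`, the flow on the
rung being `p.1 - q.1`. -/
def RungStep (ε : ℤˣ) (k : ℕ) (p q : ℤ × ℤ) : Prop :=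
  q.1 ≠ p.1 ∧ (q.1 - p.1).natAbs < k ∧ q.2 - p.2 = ε * (p.1 - q.1)

/-- The flows on the two rails are nonzero and smaller than `k`. -/
def RailBounds (k : ℕ) (p : ℤ × ℤ) : Prop :=
  (p.1 ≠ 0 ∧ p.1.natAbs < k) ∧ p.2 ≠ 0 ∧ p.2.natAbs < k

instance (ε k p q) : Decidable (RungStep ε k p q) := by unfold RungStep; infer_instance

instance (k p) : Decidable (RailBounds k p) := by unfold RailBounds; infer_instance

/-- The rail flows along a ladder of length `n` whose rungs have signs `η`. -/
structure IsLadderWalk (η : ℕ → ℤˣ) (n k : ℕ) (p : ℕ → ℤ × ℤ) : Prop where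
  step : ∀ i < n, RungStep (η i) k (p i) (p (i + 1))
  bounds : ∀ i ≤ n, RailBounds k (p i)

/-- The state of an automaton with transition function `next` after reading `n` letters of `η`. -/
def runState {Q : Type*} (next : Q → ℤˣ → Q) (q₀ : Q) (η : ℕ → ℤˣ) : ℕ → Q
  | 0 => q₀
  | i + 1 => next (runState next q₀ η i) (η i)

/-- If every position admitted in a state has a predecessor admitted in the preceding state, then
every position admitted in the last state is the end of a walk. -/
theorem exists_ladderWalk {Q : Type*} (next : Q → ℤˣ → Q) (R : Q → Finset (ℤ × ℤ)) (k : ℕ)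
    (hR : ∀ q, ∀ p ∈ R q, RailBounds k p)
    (hstep : ∀ q ε, ∀ p' ∈ R (next q ε), ∃ p ∈ R q, RungStep ε k p p')
    (q₀ : Q) (η : ℕ → ℤˣ) (n : ℕ) :
    ∀ p' ∈ R (runState next q₀ η n), ∃ p, IsLadderWalk η n k p ∧ p 0 ∈ R q₀ ∧ p n = p' := by
  induction n with
  | zero =>
    intro p' hp'
    exact ⟨fun _ => p', ⟨by simp, fun _ _ => hR _ _ hp'⟩, hp', rfl⟩
  | succ n ih =>
    intro p' hp'
    obtain ⟨x, hx, hxp⟩ := hstep _ _ p' hp'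
    obtain ⟨p, ⟨h1, h2⟩, h0, rfl⟩ := ih x hx
    refine ⟨fun i => if i ≤ n then p i else p', ⟨fun i hi => ?_, fun i hi => ?_⟩, by simpa, by simp⟩
    · rcases Nat.lt_succ_iff_lt_or_eq.mp hi with h | rfl
      · simpa [h.le, Nat.succ_le_of_lt h] using h1 i h
      · simpa using hxp
    · by_cases h : i ≤ n
      · simpa [h] using h2 i h
      · simpa [h] using hR _ _ hp'

theorem IsLadderWalk.invariant {Q : Type*} {η : ℕ → ℤˣ} {n k : ℕ} {p : ℕ → ℤ × ℤ}
    (hp : IsLadderWalk η n k p) (next : Q → ℤˣ → Q) (q₀ : Q) (I : Q → ℤ × ℤ → Prop)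
    (h0 : I q₀ (p 0))
    (hstep : ∀ q ε x y, RailBounds k x → RungStep ε k x y → I q x → I (next q ε) y) :
    I (runState next q₀ η n) (p n) := by
  suffices ∀ i ≤ n, I (runState next q₀ η i) (p i) from this n le_rfl
  intro i
  induction i with
  | zero => exact fun _ => h0
  | succ i ih => exact fun hi => hstep _ _ _ _ (hp.bounds i (by omega)) (hp.step i hi) (ih (by omega))

theorem IsLadderWalk.swap {η : ℕ → ℤˣ} {n k : ℕ} {p : ℕ → ℤ × ℤ} (hp : IsLadderWalk η n k p) :
    IsLadderWalk η n k (fun i => (p i).swap) := by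
  refine ⟨fun i hi => ?_, fun i hi => (hp.bounds i hi).symm⟩
  obtain ⟨h1, h2, h3⟩ := hp.step i hi
  simp only [RungStep, Prod.fst_swap, Prod.snd_swap]
  rcases Int.units_eq_one_or (η i) with h | h <;> rw [h] at h3 ⊢ <;>
    simp only [Units.val_one, Units.val_neg] at h3 ⊢ <;> omega

/-- Counts the rungs of sign `-1` and those of sign `1`, up to two of each. -/
def countRungs (q : Fin 3 × Fin 3) (ε : ℤˣ) : Fin 3 × Fin 3 :=
  if ε = 1 then (q.1, if q.2 = 0 then 1 else 2) else (if q.1 = 0 then 1 else 2, q.2)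

/-- In a closed walk the sum returns to its initial value, so it cannot change exactly once;
likewise the difference. Hence no count is 1. -/
theorem exists_six_walk_of_untwisted {η : ℕ → ℤˣ} {n k : ℕ} {p : ℕ → ℤ × ℤ}
    (hp : IsLadderWalk η n k p) (h : p n = p 0) :
    ∃ p', IsLadderWalk η n 6 p' ∧ p' n = p' 0 := by
  have hI := hp.invariant countRungs (0, 0) (fun q x =>
    (q.1 = 0 → x.1 + x.2 = (p 0).1 + (p 0).2) ∧ (q.1 = 1 → x.1 + x.2 ≠ (p 0).1 + (p 0).2) ∧
    (q.2 = 0 → x.1 - x.2 = (p 0).1 - (p 0).2) ∧ (q.2 = 1 → x.1 - x.2 ≠ (p 0).1 - (p 0).2))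
    (by simp) (by
      rintro ⟨i, j⟩ ε x y - ⟨h1, h2, h3⟩ hI
      rcases Int.units_eq_one_or ε with rfl | rfl <;>
        fin_cases i <;> fin_cases j <;> simp [countRungs] at hI h3 ⊢ <;> omega)
  rw [h] at hI
  -- Negative rungs move only `x.1`, positive ones only `x.2`. Both stay in {0, 1, 2}, which keeps
  -- the rail flows between 1 and 5.
  let P : Fin 3 → Finset ℤ := ![{0}, {1, 2}, {0, 1, 2}]
  let R : Fin 3 × Fin 3 → Finset (ℤ × ℤ) := fun q =>
    (P q.1 ×ˢ P q.2).image fun x => (1 + x.1 + x.2, 3 + x.1 - x.2)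
  obtain ⟨p', h1, h2, h3⟩ := exists_ladderWalk countRungs R 6 (by decide) (by decide) (0, 0) η n
    (1, 3) (by
      generalize runState countRungs (0, 0) η n = q at hI ⊢
      obtain ⟨i, j⟩ := q
      revert hI
      fin_cases i <;> fin_cases j <;> first | exact fun _ => by decide | simp)
  refine ⟨p', h1, ?_⟩
  have : R (0, 0) = {(1, 3)} := by decide
  rw [this, Finset.mem_singleton] at h2
  rw [h2, h3]

/-- Records whether there was a rung of sign `-1` and whether there was one of sign `1`. -/
def seenRungs (q : Bool × Bool) (ε : ℤˣ) : Bool × Bool :=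
  if ε = 1 then (q.1, true) else (true, q.2)

theorem exists_six_walk_of_twisted (η : ℕ → ℤˣ) {n : ℕ} (hn : n ≠ 0) :
    ∃ p, IsLadderWalk η n 6 p ∧ p n = -p 0 := by
  have key : ∀ (R : Bool × Bool → Finset (ℤ × ℤ)) (x : ℤ × ℤ) (_ : R (false, false) = {x})
      (_ : ∀ q, ∀ p ∈ R q, RailBounds 6 p)
      (_ : ∀ q ε, ∀ p' ∈ R (seenRungs q ε), ∃ p ∈ R q, RungStep ε 6 p p')
      (_ : -x ∈ R (runState seenRungs (false, false) η n)),
      ∃ p, IsLadderWalk η n 6 p ∧ p n = -p 0 := by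
    intro R x h1 h2 h3 h4
    obtain ⟨p, h5, h6, h7⟩ := exists_ladderWalk seenRungs R 6 h2 h3 _ η n _ h4
    rw [h1, Finset.mem_singleton] at h6
    exact ⟨p, h5, by rw [h6, h7]⟩
  have h0 : runState seenRungs (false, false) η n ≠ (false, false) := by
    obtain ⟨m, rfl⟩ := Nat.exists_eq_succ_of_ne_zero hn
    simp only [runState, seenRungs]
    split_ifs <;> simp
  generalize hq : runState seenRungs (false, false) η n = q at *
  let U : Bool → Finset ℤ := fun s => if s then {0, -1} else {1}
  -- `U` holds half sums and `W` half differences: |u| ≤ 1 < 2 ≤ |w| ≤ 3 keeps u ± w nonzero and at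
  -- most 4 in absolute value.
  let W : Bool → Finset ℤ := fun s => if s then {-2, 3} else {2}
  let W' : Bool → Finset ℤ := fun s => if s then {-2, 1} else {2}
  rcases q with ⟨_ | _, _ | _⟩
  · exact absurd rfl h0
  -- With only positive rungs the sum is constant, so negating the pair forces it to be 0.
  · exact key (fun q => if q.1 then ∅ else (W' q.2).image fun v => (v, -v)) (2, -2) (by decide)
      (by decide) (by decide) (by decide)
  · exact key (fun q => if q.2 then ∅ else (W' q.1).image fun v => (v, v)) (2, 2) (by decide)
      (by decide) (by decide) (by decide)
  · exact key (fun q => (U q.1 ×ˢ W q.2).image fun x => (x.1 + x.2, x.1 - x.2)) (3, -1) (by decide)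
      (by decide) (by decide) (by decide)

/-- The pattern of the maximal runs of rungs of equal sign: the sign `-1` is written `m`, the sign
`1` is written `p`, and three or more runs are not distinguished. -/
inductive RunPattern
  | empty | m | p | mp | pm | long

/-- The pattern of runs after one more rung. -/
def RunPattern.next : RunPattern → ℤˣ → RunPattern
  | empty, ε => if ε = 1 then p else m
  | m, ε => if ε = 1 then mp else m
  | p, ε => if ε = 1 then p else pm
  | mp, ε => if ε = 1 then mp else long
  | pm, ε => if ε = 1 then long else pm
  | long, _ => long

-- A walk from (a, b) to (a, -b) exchanges sum and difference. With at most one run a conserved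
-- quantity gives b = 0; with two runs the second rail flow would vanish at the turning point.
open RunPattern in
theorem exists_six_walk_of_half_twisted {η : ℕ → ℤˣ} {n k : ℕ} {w : ℕ → ℤ × ℤ}
    (hw : IsLadderWalk η n k w) (h1 : (w n).1 = (w 0).1) (h2 : (w n).2 = -(w 0).2) :
    ∃ w', IsLadderWalk η n 6 w' ∧ (w' n).1 = (w' 0).1 ∧ (w' n).2 = -(w' 0).2 := by
  have hI := hw.invariant RunPattern.next empty (fun q x => match q with
    | empty => x = w 0
    | m => x.1 - x.2 = (w 0).1 - (w 0).2
    | p => x.1 + x.2 = (w 0).1 + (w 0).2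
    | mp => ∃ y : ℤ × ℤ, y.2 ≠ 0 ∧ y.1 - y.2 = (w 0).1 - (w 0).2 ∧ x.1 + x.2 = y.1 + y.2
    | pm => ∃ y : ℤ × ℤ, y.2 ≠ 0 ∧ y.1 + y.2 = (w 0).1 + (w 0).2 ∧ x.1 - x.2 = y.1 - y.2
    | long => True) rfl (by
      rintro q ε x y hx ⟨-, -, h3⟩ hI
      have hx2 := hx.2.1
      rcases Int.units_eq_one_or ε with rfl | rfl <;> cases q <;>
        simp [RunPattern.next] at hI h3 ⊢
      · subst hI; omega
      · exact ⟨x.1, x.2, hx2, hI, by omega⟩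
      · omega
      · obtain ⟨a, b, h⟩ := hI
        exact ⟨a, b, by omega⟩
      · subst hI; omega
      · omega
      · exact ⟨x.1, x.2, hx2, hI, by omega⟩
      · obtain ⟨a, b, h⟩ := hI
        exact ⟨a, b, by omega⟩)
  have h0 := (hw.bounds 0 (Nat.zero_le _)).2.1
  have hlong : runState RunPattern.next empty η n = long := by
    generalize runState RunPattern.next empty η n = q at hI
    cases q <;> simp only [] at hI
    · rw [hI] at h2
      omega
    · omega
    · omega
    · obtain ⟨y, h⟩ := hI
      omega
    · obtain ⟨y, h⟩ := hI
      omega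
    · rfl
  -- Within a run the two pairs alternate. The four pairs of `long` form a rectangle with sums 0, 6
  -- and differences ±4, so either rung sign stays inside it.
  let R : RunPattern → Finset (ℤ × ℤ) := fun q => match q with
    | empty => {(1, -5)}
    | m => {(2, -4), (4, -2)}
    | p => {(-3, -1), (-1, -3)}
    | mp => {(-3, 1), (1, -3)}
    | pm => {(1, -1), (4, 2)}
    | long => {(-2, 2), (1, 5), (2, -2), (5, 1)}
  obtain ⟨w', h3, h4, h5⟩ := exists_ladderWalk RunPattern.next R 6
    (by intro q; cases q <;> decide) (by intro q; cases q <;> decide) empty η n (1, 5) (by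
      rw [hlong]; decide)
  have h6 : w' 0 = (1, -5) := by simpa [R] using h4
  exact ⟨w', h3, by rw [h5, h6], by rw [h5, h6]; rfl⟩

theorem exists_six_walk {η : ℕ → ℤˣ} {n k : ℕ} (hn : n ≠ 0) (δ δ' : ℤˣ) {p : ℕ → ℤ × ℤ}
    (hp : IsLadderWalk η n k p) (h1 : (p n).1 = δ * (p 0).1) (h2 : (p n).2 = δ' * (p 0).2) :
    ∃ p', IsLadderWalk η n 6 p' ∧ (p' n).1 = δ * (p' 0).1 ∧ (p' n).2 = δ' * (p' 0).2 := by
  rcases Int.units_eq_one_or δ with rfl | rfl <;> rcases Int.units_eq_one_or δ' with rfl | rfl <;>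
    simp only [Units.val_one, Units.val_neg, one_mul, neg_mul] at h1 h2 ⊢
  · obtain ⟨p', h3, h4⟩ := exists_six_walk_of_untwisted hp (Prod.ext h1 h2)
    exact ⟨p', h3, by rw [h4], by rw [h4]⟩
  · exact exists_six_walk_of_half_twisted hp h1 h2
  · obtain ⟨p', h3, h4, h5⟩ := exists_six_walk_of_half_twisted hp.swap h2 h1
    exact ⟨_, h3.swap, h5, h4⟩
  · obtain ⟨p', h3, h4⟩ := exists_six_walk_of_twisted η hn
    exact ⟨p', h3, by rw [h4]; rfl, by rw [h4]; rfl⟩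

/-! ### Translation between ladder flows and walks -/

namespace MGraph

theorem abs_lt_natCast_iff (x : ℤ) (k : ℕ) : |x| < (k : ℤ) ↔ x.natAbs < k := by
  rw [Int.abs_eq_natAbs, Int.ofNat_lt]

/-- The product of the signs of the first `i` edges on the rail `s`. -/
def railSign {n : ℕ} (σ : ZMod n ⊕ Bool × ZMod n → ℤˣ) (s : Bool) (i : ℕ) : ℤˣ :=
  ∏ j ∈ Finset.range i, σ (Sum.inr (s, (j : ZMod n)))

theorem railSign_succ {n : ℕ} (σ : ZMod n ⊕ Bool × ZMod n → ℤˣ) (s : Bool) (i : ℕ) :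
    railSign σ s (i + 1) = railSign σ s i * σ (Sum.inr (s, (i : ZMod n))) :=
  Finset.prod_range_succ _ _

/-- The sign of the `i`-th rung after switching to make the rails positive. -/
def rungSign {n : ℕ} (σ : ZMod n ⊕ Bool × ZMod n → ℤˣ) (i : ℕ) : ℤˣ :=
  σ (Sum.inl (i : ZMod n)) * railSign σ false i * railSign σ true i

theorem rungStep_iff (ε : ℤˣ) (k : ℕ) (p q : ℤ × ℤ) : RungStep ε k p q ↔
    ∃ r : ℤ, r ≠ 0 ∧ |r| < (k : ℤ) ∧ q.1 = p.1 - r ∧ q.2 = p.2 + ε * r := by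
  constructor
  · rintro ⟨h1, h2, h3⟩
    exact ⟨p.1 - q.1, by omega, by rw [abs_lt_natCast_iff]; omega, by omega, by omega⟩
  · rintro ⟨r, h1, h2, h3, h4⟩
    rw [abs_lt_natCast_iff] at h2
    refine ⟨by omega, by omega, ?_⟩
    rw [h3, h4]
    ring

theorem IsHalfEdgeFlow.exists_ladderWalk {n : ℕ} [NeZero n]
    {σ : ZMod n ⊕ Bool × ZMod n → ℤˣ} {k : ℕ} {F : (ZMod n ⊕ Bool × ZMod n) × Bool → ℤ}
    (hF : (circularLadder n).IsHalfEdgeFlow σ k F) :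
    ∃ p, IsLadderWalk (rungSign σ) n k p ∧ (p n).1 = railSign σ false n * (p 0).1 ∧
      (p n).2 = railSign σ true n * (p 0).2 := by
  have hv := ((isHalfEdgeFlow_circularLadder_iff n σ k F).mp hF).2.2
  -- the flow arriving at the `i`-th vertex of the rail `s`, after switching
  let x : Bool → ℕ → ℤ := fun s i => -(railSign σ s i * F (Sum.inr (s, (i : ZMod n) - 1), true))
  have hx0 : ∀ s i, x s i ≠ 0 := fun s i => by simp [x, hF.ne_zero]
  have hxk : ∀ s i, |x s i| < (k : ℤ) := fun s i => by
    simp only [x, abs_neg, abs_units_mul]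
    exact hF.abs_lt _
  have hx : ∀ s i, x s (i + 1) = x s i - railSign σ s i * F (Sum.inl (i : ZMod n), s) := by
    intro s i
    have h1 := hv s ((i : ZMod n) - 1)
    have h2 := hF.flip (Sum.inr (s, (i : ZMod n))) false
    rw [sub_add_cancel] at h1
    simp only [Bool.not_false] at h2
    simp only [x, Nat.cast_add, Nat.cast_one, add_sub_cancel_right, h2, railSign_succ,
      Units.val_mul]
    rw [neg_mul, mul_neg, neg_neg, mul_assoc, units_mul_self_mul]
    linear_combination (railSign σ s i : ℤ) * h1
  refine ⟨fun i => (x false i, x true i), ⟨fun i _ => ?_, fun i _ => ?_⟩, ?_, ?_⟩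
  · rw [rungStep_iff]
    refine ⟨railSign σ false i * F (Sum.inl (i : ZMod n), false), by simp [hF.ne_zero], ?_,
      hx _ _, ?_⟩
    · rw [abs_units_mul]
      exact hF.abs_lt _
    · have h2 := hF.flip (Sum.inl (i : ZMod n)) false
      simp only [Bool.not_false] at h2
      have h3 := units_mul_self_mul (railSign σ false i) (F (Sum.inl (i : ZMod n), false))
      simp only [hx, h2, rungSign, Units.val_mul]
      linear_combination -((σ (Sum.inl (i : ZMod n)) : ℤ) * railSign σ true i) * h3
  · exact ⟨⟨hx0 _ _, (abs_lt_natCast_iff _ _).mp (hxk _ _)⟩, hx0 _ _,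
      (abs_lt_natCast_iff _ _).mp (hxk _ _)⟩
  · simp [x, railSign]
  · simp [x, railSign]

theorem exists_isHalfEdgeFlow_of_ladderWalk {n : ℕ} [NeZero n]
    {σ : ZMod n ⊕ Bool × ZMod n → ℤˣ} {k : ℕ} {p : ℕ → ℤ × ℤ}
    (hp : IsLadderWalk (rungSign σ) n k p) (h1 : (p n).1 = railSign σ false n * (p 0).1)
    (h2 : (p n).2 = railSign σ true n * (p 0).2) :
    ∃ F, (circularLadder n).IsHalfEdgeFlow σ k F := by
  let x : Bool → ℕ → ℤ := fun s i => if s then (p i).2 else (p i).1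
  have hx : ∀ s, x s n = railSign σ s n * x s 0 := by
    rintro (_ | _)
    · exact h1
    · exact h2
  have hxb : ∀ s, ∀ i ≤ n, x s i ≠ 0 ∧ |x s i| < (k : ℤ) := by
    simp only [abs_lt_natCast_iff]
    rintro (_ | _) i hi
    · exact (hp.bounds i hi).1
    · exact (hp.bounds i hi).2
  -- the flow on the tail half edges of the rungs and rails
  let f : ZMod n ⊕ Bool × ZMod n → ℤ := fun e => match e with
    | Sum.inl i => railSign σ false i.val * (x false i.val - x false (i.val + 1))
    | Sum.inr (s, i) => railSign σ s i.val * x s (i.val + 1)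
  have harrive : ∀ s (i : ZMod n), (σ (Sum.inr (s, i)) : ℤ) * f (Sum.inr (s, i)) =
      railSign σ s (i + 1).val * x s (i + 1).val := by
    intro s i
    have h3 := railSign_succ σ s i.val
    rw [ZMod.natCast_zmod_val] at h3
    have h4 : (σ (Sum.inr (s, i)) : ℤ) * f (Sum.inr (s, i)) =
        railSign σ s (i.val + 1) * x s (i.val + 1) := by
      rw [h3, Units.val_mul]
      simp only [f]
      ring
    rw [h4]
    -- The last rail returns to vertex 0, where the sign product restarts at 1; the closing
    -- condition `hx` absorbs the discrepancy.
    rcases Nat.lt_or_ge (i.val + 1) n with h | h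
    · have h5 : (i + 1).val = i.val + 1 := by
        rw [← ZMod.natCast_zmod_val i, ← Nat.cast_one, ← Nat.cast_add, ZMod.natCast_zmod_val,
          ZMod.val_cast_of_lt h]
      rw [h5]
    · have h5 : i.val + 1 = n := le_antisymm (ZMod.val_lt i) h
      have h6 : i + 1 = 0 := by
        rw [← ZMod.natCast_zmod_val i, ← Nat.cast_one, ← Nat.cast_add, h5, ZMod.natCast_self]
      rw [h6, h5, ZMod.val_zero, hx, units_mul_self_mul]
      simp [railSign]
  refine ⟨fun h => if h.2 then -(σ h.1 : ℤ) * f h.1 else f h.1,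
    (isHalfEdgeFlow_circularLadder_iff n σ k _).mpr ⟨fun e => by simp, fun e => ?_, fun s i => ?_⟩⟩
  · simp only [Bool.false_eq_true, if_false]
    rcases e with i | ⟨s, i⟩
    · obtain ⟨h3, h4, -⟩ := hp.step i.val (ZMod.val_lt i)
      simp only [f, abs_units_mul, abs_lt_natCast_iff]
      refine ⟨mul_ne_zero (Units.ne_zero _) ?_, ?_⟩ <;> simp only [x] <;> simp <;> omega
    · have := hxb s (i.val + 1) (ZMod.val_lt i)
      simp only [f, abs_units_mul]
      exact ⟨mul_ne_zero (Units.ne_zero _) this.1, this.2⟩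
  · have h3 := harrive s i
    generalize i + 1 = j at h3 ⊢
    obtain ⟨-, -, h4⟩ := hp.step j.val (ZMod.val_lt j)
    have h5 := units_mul_self_mul (railSign σ true j.val)
    simp only [rungSign, ZMod.natCast_zmod_val, Units.val_mul] at h4
    simp only [if_true, Bool.false_eq_true, if_false, neg_mul, h3]
    cases s
    · simp only [Bool.false_eq_true, if_false, f]
      ring
    · simp only [if_true, f]
      have h6 := h5 ((σ (Sum.inl j) : ℤ) * railSign σ false j.val * (x false j.val - x false (j.val + 1)))
      simp only [x] at h6 ⊢
      simp at h6 ⊢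
      linear_combination (railSign σ true j.val : ℤ) * h4 + h6

end MGraph

theorem theorem5p6 {V E : Type*} [Fintype E] (G : MGraph V E) (hG : G.IsCircularLadder)
    (σ : E → ℤˣ) (hσ : G.FlowAdmissible σ) : G.HasNowhereZeroFlow σ 6 := by
  obtain ⟨n, hn, ⟨i⟩⟩ := hG
  obtain ⟨k, -, h⟩ := hσ
  have : NeZero n := ⟨by omega⟩
  rw [i.hasNowhereZeroFlow_iff, MGraph.hasNowhereZeroFlow_iff] at h ⊢
  obtain ⟨F, hF⟩ := h
  obtain ⟨p, h1, h2, h3⟩ := hF.exists_ladderWalk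
  obtain ⟨p', h4, h5, h6⟩ := exists_six_walk (NeZero.ne n) _ _ h1 h2 h3
  exact MGraph.exists_isHalfEdgeFlow_of_ladderWalk h4 h5 h6
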